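/- A (commutative) binoid is a commutative monoid $(N,+,0,\infty)$ with an absorbing element $\infty$; put $N^\bullet=N\setminus\{\infty\}$. It is positive if $0\neq\infty$ and $0$ is its only unit, integral if $a+b=\infty$ implies $a=\infty$ or $b=\infty$, cancellative if $a+b=a+c\neq\infty$ implies $b=c$, and torsion-free if $na=nb$ with $n\ge 1$ implies $a=b$. An $N$-set is a pointed set $(S,p)$ with an operation of the monoid $N$ such that $\infty+s=p$ and $n+p=p$ for all $s\in S$, $n\in N$; an $N$-subset of $S$ is a subset that contains $p$ and is stable under $N$. The $N$-subsets $S$ and $\{p\}$ are called trivial, and $S\neq\{p\}$ is called reducible if it is a union of non-trivial $N$-subsets any two of which meet only in $p$, and irreducible otherwise. An irreducible component of $S$ is an irreducible $N$-subset $T$ such that every $N$-subset $T'$ with $T\subsetneq T'\subseteq S$ is reducible. For an integer $q\ge 1$ let ${}^qN$ be the $N$-set with underlying pointed set $(N,\infty)$ and operation $n\dotplus a=qn+a$. A minimal generator of an $N$-set $S$ is a member of a subset $G\subseteq S$ that is minimal, with respect to inclusion, among the subsets with $N+G=S$. Let $N$ be a finitely generated, positive, integral, cancellative and torsion-free binoid.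 (1) Up to isomorphism of $N$-sets, only finitely many $N$-sets occur among the irreducible components of the $N$-sets ${}^qN$, where $q$ runs through all positive integers. (2) Let $\operatorname{diff}N$ be the difference binoid of $N$, that is, the localization of $N$ at $N^\bullet$, so that $N\subseteq\operatorname{diff}N$, and identify its group of units $(\operatorname{diff}N)^\bullet$ with $\mathbb Z^d$ by any group isomorphism. For $q\ge1$ and $x\in\mathbb Z^d$ consider the $N$-set $L_q(x,N)=\{m\in\operatorname{diff}N\mid x+qm\in N\}$. Then there is a constant $C$ such that for all $q\geq 1$ and all $x=(x_1,\dots,x_d)\in\mathbb Z^d$ with $0\le x_i\le q-1$ for all $i$, every minimal generator $a$ of $L_q(x,N)$ lies in $\mathbb Z^d$ and its coordinates satisfy $|a_i|\le C$. The constant $C$ depends neither on $q$ nor on $x$. -/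

import Mathlib

/-!
Commutative binoids and their sets.

A commutative binoid `(N, +, 0, ∞)` is a commutative monoid with an absorbing element.  This is
Mathlib's `CommMonoidWithZero`, which is written multiplicatively: the sum `a + b` of the binoid
is `a * b`, its neutral element `0` is `1`, its absorbing element `∞` is `0`, and the multiple
`q a` is `a ^ q`.  An `N`-set `(S, p)` is a pointed set with an operation of `N` such that `0`
acts as the identity, `∞` sends everything to `p`, and `p` is fixed; this is Mathlib's
`MulActionWithZero N S`, the base point `p` being `0 : S`.
-/

universe u v w

namespace Binoid

/-- An `N`-subset of an `N`-set `S`: a subset which contains the base point and is stable under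
the operation. -/
structure NSubset (N : Type u) (S : Type v) [CommMonoidWithZero N] [Zero S]
    [MulActionWithZero N S] where
  carrier : Set S
  zero_mem' : (0 : S) ∈ carrier
  smul_mem' : ∀ (n : N) (s : S), s ∈ carrier → n • s ∈ carrier

namespace NSubset

variable {N : Type u} {S : Type v} [CommMonoidWithZero N] [Zero S] [MulActionWithZero N S]

instance : SetLike (NSubset N S) S where
  coe T := T.carrier
  coe_injective T T' h := by
    cases T
    cases T'
    congr

/-- Inclusion of `N`-subsets is inclusion of the underlying sets. -/
instance : PartialOrder (NSubset N S) := PartialOrder.ofSetLike (NSubset N S) S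

/-- An `N`-subset is itself an `N`-set. -/
instance (T : NSubset N S) : Zero T := ⟨⟨0, T.zero_mem'⟩⟩

instance (T : NSubset N S) : MulActionWithZero N T where
  smul n s := ⟨n • (s : S), T.smul_mem' n s s.2⟩
  one_smul s := Subtype.ext (one_smul N (s : S))
  mul_smul n m s := Subtype.ext (mul_smul n m (s : S))
  smul_zero n := Subtype.ext (smul_zero (A := S) n)
  zero_smul s := Subtype.ext (zero_smul N (s : S))

/-- The trivial `N`-subsets of `S` are `S` and `{p}`. -/
def IsTrivial (T : NSubset N S) : Prop :=
  (T : Set S) = Set.univ ∨ (T : Set S) = {0}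

end NSubset

section NSets

variable (N : Type u) (S : Type v) [CommMonoidWithZero N] [Zero S] [MulActionWithZero N S]

/-- `S` is the pointed union of the members of the family `𝒯` of `N`-subsets: they cover `S`, and
any two different ones meet only in the base point. -/
def IsPointedUnion (𝒯 : Set (NSubset N S)) : Prop :=
  (∀ s : S, ∃ T ∈ 𝒯, s ∈ T) ∧
    ∀ T ∈ 𝒯, ∀ T' ∈ 𝒯, T ≠ T' → (T : Set S) ∩ (T' : Set S) = {0}

/-- An `N`-set `S ≠ {p}` is reducible if it is a pointed union of non-trivial `N`-subsets. -/
def IsReducible : Prop :=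
  (∃ s : S, s ≠ 0) ∧
    ∃ 𝒯 : Set (NSubset N S), (∀ T ∈ 𝒯, ¬ T.IsTrivial) ∧ IsPointedUnion N S 𝒯

/-- An `N`-set `S ≠ {p}` is irreducible if it is not a pointed union of non-trivial
`N`-subsets. -/
def IsIrreducible : Prop :=
  (∃ s : S, s ≠ 0) ∧
    ¬ ∃ 𝒯 : Set (NSubset N S), (∀ T ∈ 𝒯, ¬ T.IsTrivial) ∧ IsPointedUnion N S 𝒯

variable {N S} in
/-- An irreducible component of `S`: an irreducible `N`-subset `T` such that every `N`-subset of
`S` which is strictly larger than `T` is reducible. -/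
def IsIrreducibleComponent (T : NSubset N S) : Prop :=
  IsIrreducible N T ∧ ∀ T' : NSubset N S, T < T' → IsReducible N T'

variable {S} in
/-- `G` generates the `N`-set `S`. -/
def IsGeneratingSet (G : Set S) : Prop :=
  ∀ s : S, ∃ n : N, ∃ g ∈ G, s = n • g

variable {S} in
/-- `s` is a minimal generator of the `N`-set `S`: a member of a generating set of `S` that is
minimal with respect to inclusion. -/
def IsMinimalGenerator (s : S) : Prop :=
  ∃ G : Set S, Minimal (IsGeneratingSet N) G ∧ s ∈ G

/-- Isomorphism of `N`-sets: a bijection compatible with base points and operations. -/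
def AreIsomorphic (T : Type w) [Zero T] [MulActionWithZero N T] : Prop :=
  ∃ f : S ≃ T, f 0 = 0 ∧ ∀ (n : N) (s : S), f (n • s) = n • f s

end NSets

/-- The `N`-set `^qN` for a positive integer `q`: the pointed set `N`, on which `n` operates as
the addition of `q n` (multiplicatively written, as the multiplication by `n ^ q`). -/
def FrobeniusSet (N : Type u) (_q : ℕ+) : Type u := N

section FrobeniusSet

variable (N : Type u) [CommMonoidWithZero N] (q : ℕ+)

instance : Zero (FrobeniusSet N q) := ⟨(0 : N)⟩

instance : MulActionWithZero N (FrobeniusSet N q) where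
  smul n s := (n ^ (q : ℕ) * (show N from s) : N)
  one_smul s := show (1 : N) ^ (q : ℕ) * (show N from s) = s by rw [one_pow, one_mul]
  mul_smul n m s :=
    show (n * m) ^ (q : ℕ) * (show N from s) = n ^ (q : ℕ) * (m ^ (q : ℕ) * (show N from s)) by
      rw [mul_pow, mul_assoc]
  smul_zero n := mul_zero (n ^ (q : ℕ))
  zero_smul s := show (0 : N) ^ (q : ℕ) * (show N from s) = (0 : N) by
    rw [zero_pow q.ne_zero, zero_mul]

/-- The irreducible components of all the `N`-sets `^qN`, `q ≥ 1`. -/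
structure FrobeniusComponent where
  q : ℕ+
  component : NSubset N (FrobeniusSet N q)
  isComponent : IsIrreducibleComponent component

/-- The relation of being isomorphic as `N`-sets, on the irreducible components of all `^qN`. -/
instance frobeniusComponentSetoid : Setoid (FrobeniusComponent N) where
  r A B := AreIsomorphic N A.component B.component
  iseqv :=
    { refl := fun _ => ⟨Equiv.refl _, rfl, fun _ _ => rfl⟩
      symm := by
        rintro _ _ ⟨f, h0, hf⟩
        refine ⟨f.symm, by rw [Equiv.symm_apply_eq, h0], fun n s => ?_⟩
        rw [Equiv.symm_apply_eq, hf, Equiv.apply_symm_apply]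
      trans := by
        rintro _ _ _ ⟨f, h0, hf⟩ ⟨g, k0, hg⟩
        refine ⟨f.trans g, by rw [Equiv.trans_apply, h0, k0], fun n s => ?_⟩
        rw [Equiv.trans_apply, Equiv.trans_apply, hf, hg] }

/-- The isomorphism classes of `N`-sets which occur among the irreducible components of the
`N`-sets `^qN`, for all `q ≥ 1` together. -/
def FrobeniusComponentClasses : Type u := Quotient (frobeniusComponentSetoid N)

end FrobeniusSet

/-- The difference binoid `diff N`: the localization of `N` at the submonoid generated by the
elements different from the absorbing one. -/
def DiffBinoid (N : Type u) [CommMonoidWithZero N] : Type u :=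
  Localization (Submonoid.closure {a : N | a ≠ 0})

section DiffBinoid

variable (N : Type u) [CommMonoidWithZero N]

instance : CommMonoidWithZero (DiffBinoid N) :=
  inferInstanceAs (CommMonoidWithZero (Localization (Submonoid.closure {a : N | a ≠ 0})))

/-- The canonical homomorphism from `N` to `diff N`. -/
def toDiff : N →* DiffBinoid N :=
  (Localization.monoidOf (Submonoid.closure {a : N | a ≠ 0})).toMonoidHom

theorem toDiff_zero : toDiff N 0 = 0 :=
  map_zero (Localization.monoidOf (Submonoid.closure {a : N | a ≠ 0}))

/-- `diff N` is an `N`-set via the canonical homomorphism. -/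
instance : MulActionWithZero N (DiffBinoid N) where
  smul n m := toDiff N n * m
  one_smul m := show toDiff N 1 * m = m by rw [map_one, one_mul]
  mul_smul n k m := show toDiff N (n * k) * m = toDiff N n * (toDiff N k * m) by
    rw [map_mul, mul_assoc]
  smul_zero n := mul_zero (toDiff N n)
  zero_smul m := show toDiff N 0 * m = 0 by rw [toDiff_zero, zero_mul]

/-- The `N`-set `L_q(x, N) = {m ∈ diff N | x + q m ∈ N}`, for `x` in `diff N`. -/
def LSet (q : ℕ+) (x : DiffBinoid N) : NSubset N (DiffBinoid N) where
  carrier := {m | x * m ^ (q : ℕ) ∈ Set.range (toDiff N)}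
  zero_mem' := ⟨0, by rw [toDiff_zero, zero_pow q.ne_zero, mul_zero]⟩
  smul_mem' := by
    rintro n m ⟨k, hk⟩
    refine ⟨n ^ (q : ℕ) * k, ?_⟩
    change _ = x * (toDiff N n * m) ^ (q : ℕ)
    rw [map_mul, map_pow, hk, mul_pow, mul_left_comm]

end DiffBinoid

end Binoid

/-!
Both claims come from division with remainder of exponents.  Let `S` be a finite set of generators
of `N`, without the absorbing element.  A nonabsorbing `y = ∏ s ^ f s` is `n ^ q * ∏ s ^ r s` with
`n` nonabsorbing and `r s < q` (`exists_eq_pow_mul_prod`).  Applied to `x * m ^ q ∈ N`, this writes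
`m ∈ L_q(x, N)` as `n • b`, where `x * b ^ q = ∏ s ^ r s`.  If the coordinates of `x` lie in
`[0, q - 1]`, then in additive notation `q b = ∑ r s • s - x` has all coordinates at most `q * C`
in absolute value, where `C = 1 + ∑ |s|` does not depend on `q` and `x`; hence `|b_i| ≤ C`.  So
`L_q(x, N)` is generated by its elements in a fixed box (`exists_bounded_generators`).

As `N` is positive and cancellative, a minimal generator `a = n • b` equals `b`
(`IsMinimalGenerator.eq_of_eq_smul`), which bounds the minimal generators.

For the finiteness, call two elements `s`, `t` of an `N`-set linked if `n • s = m • t` with `n`, `m`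
nonabsorbing.  An irreducible component is a class of linked elements together with the base point
(`IsIrreducibleComponent.eq_linkClass`).  In `^qN`, two elements are linked exactly if they differ
by a `q`-th multiple in the difference group, so the class of `y` is isomorphic to `L_q(x, N)` for
every `x` congruent to `y` modulo `q` (`areIsomorphic_LSet_linkClass`), and `x` may be taken with
coordinates in `[0, q - 1]`.  Then `L_q(x, N)` is determined by its elements in the fixed box,
which has only finitely many subsets.
-/

namespace Binoid

/-! ### Linked elements and irreducible components -/

section Linked

variable {N : Type u} {S : Type v} [CommMonoidWithZero N] [Zero S] [MulActionWithZero N S]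

variable (N) in
/-- Two elements of an `N`-set are linked if they have a common multiple by nonabsorbing elements
of `N`. -/
def Linked (s t : S) : Prop :=
  ∃ n m : N, n ≠ 0 ∧ m ≠ 0 ∧ n • s = m • t

theorem Linked.symm {s t : S} (h : Linked N s t) : Linked N t s := by
  obtain ⟨n, m, hn, hm, h⟩ := h
  exact ⟨m, n, hm, hn, h.symm⟩

theorem Linked.trans [NoZeroDivisors N] {s t r : S} (h : Linked N s t) (h' : Linked N t r) :
    Linked N s r := by
  obtain ⟨n, m, hn, hm, h⟩ := h
  obtain ⟨n', m', hn', hm', h'⟩ := h'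
  refine ⟨n' * n, m * m', mul_ne_zero hn' hn, mul_ne_zero hm hm', ?_⟩
  rw [mul_smul, h, mul_smul, ← h', ← mul_smul, ← mul_smul, mul_comm]

theorem Linked.refl [Nontrivial N] (s : S) : Linked N s s :=
  ⟨1, 1, one_ne_zero, one_ne_zero, rfl⟩

variable [NoZeroDivisors N]

variable (N) in
/-- The class of the elements linked to `s`, together with the base point. -/
def linkClass (s : S) : NSubset N S where
  carrier := {t | t = 0 ∨ Linked N t s}
  zero_mem' := Or.inl rfl
  smul_mem' := by
    rintro k t (rfl | ⟨n, m, hn, hm, h⟩)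
    · exact Or.inl (smul_zero k)
    · by_cases hk : k = 0
      · exact Or.inl (by rw [hk, zero_smul])
      · refine Or.inr ⟨n, k * m, hn, mul_ne_zero hk hm, ?_⟩
        rw [← mul_smul, mul_comm n k, mul_smul, h, mul_smul]

theorem mem_linkClass {s t : S} : t ∈ linkClass N s ↔ t = 0 ∨ Linked N t s :=
  Iff.rfl

variable [Nontrivial N]

theorem self_mem_linkClass (s : S) : s ∈ linkClass N s :=
  Or.inr (Linked.refl s)

/-- A class is irreducible since a common multiple of two of its elements lies in every `N`-subset
that contains one of them. -/
theorem isIrreducible_linkClass (hS : ∀ (n : N) (s : S), n • s = 0 → n = 0 ∨ s = 0)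
    {s : S} (hs : s ≠ 0) : IsIrreducible N (linkClass N s) := by
  refine ⟨⟨⟨s, self_mem_linkClass s⟩, fun h => hs (congrArg Subtype.val h)⟩, ?_⟩
  rintro ⟨𝒯, hnt, hcov, hdisj⟩
  obtain ⟨T, hT, hsT⟩ := hcov ⟨s, self_mem_linkClass s⟩
  obtain ⟨t, ht⟩ : ∃ t, t ∉ T := by
    by_contra! h
    exact hnt T hT (Or.inl (Set.eq_univ_of_forall h))
  obtain ⟨T', hT', htT'⟩ := hcov t
  obtain h0 | ⟨n, m, hn, hm, h⟩ := mem_linkClass.1 t.2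
  · exact ht ((show t = 0 from Subtype.ext h0) ▸ T.zero_mem')
  · have hne : T ≠ T' := by
      rintro rfl
      exact ht htT'
    have hmem : m • (⟨s, self_mem_linkClass s⟩ : linkClass N s) ∈
        (T : Set (linkClass N s)) ∩ (T' : Set (linkClass N s)) := by
      refine ⟨T.smul_mem' m _ hsT, ?_⟩
      rw [← show n • t = m • (⟨s, self_mem_linkClass s⟩ : linkClass N s) from Subtype.ext h]
      exact T'.smul_mem' n _ htT'
    rw [hdisj T hT T' hT' hne] at hmem
    exact (hS m s (congrArg Subtype.val hmem)).elim hm hs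

/-- An `N`-subset other than `{p}` is the pointed union of its intersections with the classes, so
an irreducible one lies in a single class. -/
theorem IsIrreducible.le_linkClass {T : NSubset N S} (hT : IsIrreducible N T) {s : S}
    (hsT : s ∈ T) (hs : s ≠ 0) : T ≤ linkClass N s := by
  by_contra hle
  let piece (t : S) : NSubset N T :=
    { carrier := {r | (r : S) ∈ linkClass N t}
      zero_mem' := (linkClass N t).zero_mem'
      smul_mem' := fun n r hr => (linkClass N t).smul_mem' n r hr }
  refine hT.2 ⟨{U | ∃ t ∈ T, t ≠ 0 ∧ U = piece t}, ?_, ?_, ?_⟩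
  · rintro _ ⟨t, htT, ht, rfl⟩ (h | h)
    · have hall : ∀ r ∈ T, r ∈ linkClass N t := fun r hr =>
        (h.symm ▸ Set.mem_univ (⟨r, hr⟩ : T) : (⟨r, hr⟩ : T) ∈ (piece t : Set T))
      refine hle fun r hr => ?_
      refine (hall r hr).imp id fun hrt => hrt.trans ?_
      exact ((hall s hsT).resolve_left hs).symm
    · have hmem : (⟨t, htT⟩ : T) ∈ (piece t : Set T) := self_mem_linkClass t
      rw [h] at hmem
      exact ht (congrArg Subtype.val hmem)
  · intro r
    by_cases hr : (r : S) = 0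
    · exact ⟨piece s, ⟨s, hsT, hs, rfl⟩, Or.inl hr⟩
    · exact ⟨piece r, ⟨r, r.2, hr, rfl⟩, self_mem_linkClass (r : S)⟩
  · rintro _ ⟨t, htT, ht, rfl⟩ _ ⟨t', htT', ht', rfl⟩ hne
    refine Set.Subset.antisymm ?_ ?_
    · rintro r ⟨h | h, h' | h'⟩
      · exact Subtype.ext h
      · exact Subtype.ext h
      · exact Subtype.ext h'
      · refine absurd (SetLike.ext fun z => ?_) hne
        exact ⟨Or.imp id fun hz => hz.trans (h.symm.trans h'),
          Or.imp id fun hz => hz.trans (h'.symm.trans h)⟩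
    · rintro _ rfl
      exact ⟨(piece t).zero_mem', (piece t').zero_mem'⟩

theorem IsIrreducibleComponent.eq_linkClass
    (hS : ∀ (n : N) (s : S), n • s = 0 → n = 0 ∨ s = 0) {T : NSubset N S}
    (hT : IsIrreducibleComponent T) {s : S} (hsT : s ∈ T) (hs : s ≠ 0) : T = linkClass N s := by
  by_contra hne
  have hlt : T < linkClass N s := lt_of_le_of_ne (hT.1.le_linkClass hsT hs) hne
  exact (isIrreducible_linkClass hS hs).2 (hT.2 _ hlt).2

end Linked

/-! ### Minimal generators -/

section MinimalGenerator

variable {N : Type u} {S : Type v} [CommMonoidWithZero N] [Zero S] [MulActionWithZero N S]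

/-- A generating set stays generating without an element which is a multiple of another one. -/
theorem eq_of_eq_smul_of_minimal {G : Set S} (hG : Minimal (IsGeneratingSet N) G)
    {a b : S} (ha : a ∈ G) (hb : b ∈ G) {n : N} (h : a = n • b) : a = b := by
  by_contra hab
  have hgen : IsGeneratingSet N (G \ {a}) := by
    intro s
    obtain ⟨k, g, hg, rfl⟩ := hG.prop s
    by_cases hga : g = a
    · exact ⟨k * n, b, ⟨hb, fun hba => hab hba.symm⟩, by rw [hga, h, mul_smul]⟩
    · exact ⟨k, g, ⟨hg, hga⟩, rfl⟩
  exact (hG.le_of_le hgen Set.sdiff_subset ha).2 rfl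

theorem IsMinimalGenerator.ne_zero {a : S} (ha : IsMinimalGenerator N a) {s : S} (hs : s ≠ 0) :
    a ≠ 0 := by
  obtain ⟨G, hG, haG⟩ := ha
  rintro rfl
  obtain ⟨k, g, hg, rfl⟩ := hG.prop s
  have hg0 : (0 : S) = g := eq_of_eq_smul_of_minimal hG haG hg (zero_smul N g).symm
  exact hs (by rw [← hg0, smul_zero])

/-- If `a = n • b` with `b = k • g` for some `g` in a minimal generating set containing `a`, then
`g = a`, so `n * k` fixes `a`; hence `n * k = 1`, and `k = 1` by positivity. -/
theorem IsMinimalGenerator.eq_of_eq_smul [Subsingleton Nˣ] {a b : S}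
    (ha : IsMinimalGenerator N a) (hfree : ∀ n : N, n • a = a → n = 1) {n : N}
    (h : a = n • b) : a = b := by
  obtain ⟨G, hG, haG⟩ := ha
  obtain ⟨k, g, hg, rfl⟩ := hG.prop b
  rw [← mul_smul] at h
  obtain rfl : a = g := eq_of_eq_smul_of_minimal hG haG hg h
  have hnk : n * k = 1 := hfree _ h.symm
  have hk : k = 1 :=
    congrArg Units.val (Subsingleton.elim (Units.mkOfMulEqOne k n (by rw [mul_comm, hnk])) 1)
  rw [hk, one_smul]

end MinimalGenerator

/-! ### The difference binoid -/

section DiffBinoid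

variable {N : Type u} [CommMonoidWithZero N]

theorem smul_diffBinoid_def (n : N) (m : DiffBinoid N) : n • m = toDiff N n * m :=
  rfl

theorem isUnit_toDiff {a : N} (ha : a ≠ 0) : IsUnit (toDiff N a) :=
  (Localization.monoidOf (Submonoid.closure {a : N | a ≠ 0})).map_units
    ⟨a, Submonoid.subset_closure ha⟩

variable (N) in
/-- Units of the difference binoid that represent the nonabsorbing elements of `N`. -/
theorem exists_unit_toDiff :
    ∃ v : N → (DiffBinoid N)ˣ, ∀ a ≠ 0, (v a : DiffBinoid N) = toDiff N a := by
  classical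
  refine ⟨fun a => if h : a = 0 then 1 else (isUnit_toDiff h).unit, fun a ha => ?_⟩
  simp [ha]

variable [Nontrivial N] [NoZeroDivisors N]

theorem mem_closure_ne_zero {a : N} : a ∈ Submonoid.closure {a : N | a ≠ 0} ↔ a ≠ 0 := by
  refine ⟨fun h => ?_, fun h => Submonoid.subset_closure h⟩
  induction h using Submonoid.closure_induction with
  | mem _ h => exact h
  | one => exact one_ne_zero
  | mul _ _ _ _ ha hb => exact mul_ne_zero ha hb

theorem exists_mul_toDiff_eq (m : DiffBinoid N) :
    ∃ a b : N, b ≠ 0 ∧ m * toDiff N b = toDiff N a := by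
  obtain ⟨⟨a, b⟩, h⟩ := (Localization.monoidOf (Submonoid.closure {a : N | a ≠ 0})).surj m
  exact ⟨a, b, mem_closure_ne_zero.1 b.2, h⟩

theorem isUnit_of_ne_zero {m : DiffBinoid N} (hm : m ≠ 0) : IsUnit m := by
  obtain ⟨a, b, hb, h⟩ := exists_mul_toDiff_eq m
  have ha : a ≠ 0 := by
    rintro rfl
    rw [toDiff_zero] at h
    exact hm ((isUnit_toDiff hb).mul_left_eq_zero.1 h)
  exact isUnit_of_mul_isUnit_left (h ▸ isUnit_toDiff ha)

variable [IsCancelMulZero N]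

theorem toDiff_injective : Function.Injective (toDiff N) := by
  intro a b h
  obtain ⟨c, hc⟩ :=
    (Localization.monoidOf (Submonoid.closure {a : N | a ≠ 0})).exists_of_eq h
  exact mul_left_cancel₀ (mem_closure_ne_zero.1 c.2) hc

instance : Nontrivial (DiffBinoid N) :=
  toDiff_injective.nontrivial

instance [IsMulTorsionFree N] : IsMulTorsionFree (DiffBinoid N) where
  pow_left_injective n hn m m' h := by
    obtain ⟨a, b, hb, hab⟩ := exists_mul_toDiff_eq m
    obtain ⟨a', b', hb', hab'⟩ := exists_mul_toDiff_eq m'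
    change m ^ n = m' ^ n at h
    have hpow : (a * b') ^ n = (a' * b) ^ n := by
      apply toDiff_injective
      rw [map_pow, map_pow, map_mul, map_mul, ← hab, ← hab', mul_assoc, mul_assoc, mul_pow,
        mul_pow m', h, mul_comm (toDiff N b)]
    have hcross := congrArg (toDiff N) (pow_left_injective hn hpow)
    simp only [map_mul, ← hab, ← hab'] at hcross
    refine ((isUnit_toDiff hb).mul (isUnit_toDiff hb')).mul_left_injective ?_
    change m * (toDiff N b * toDiff N b') = m' * (toDiff N b * toDiff N b')
    rw [← mul_assoc, hcross]
    ac_rfl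

instance [IsMulTorsionFree N] : IsMulTorsionFree (DiffBinoid N)ˣ :=
  Units.val_injective.isMulTorsionFree (Units.coeHom _)

end DiffBinoid

/-! ### Division with remainder -/

section Generators

variable (N : Type u) [CommMonoidWithZero N]

theorem exists_finset_generators [Monoid.FG N] :
    ∃ S : Finset N, (∀ s ∈ S, s ≠ 0) ∧ ∀ y : N, y ≠ 0 → ∃ f : N → ℕ, y = ∏ s ∈ S, s ^ f s := by
  classical
  obtain ⟨S, hS⟩ := Monoid.fg_def.1 ‹Monoid.FG N›
  refine ⟨S.erase 0, fun s hs => Finset.ne_of_mem_erase hs, fun y hy => ?_⟩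
  obtain ⟨f, -, hf⟩ := Submonoid.mem_closure_finset.1 (hS ▸ Submonoid.mem_top y)
  refine ⟨f, ?_⟩
  rw [← hf]
  by_cases h0 : (0 : N) ∈ S
  · have hf0 : f 0 = 0 := by
      by_contra hne
      exact hy (hf.symm.trans (Finset.prod_eq_zero h0 (zero_pow hne)))
    rw [← Finset.mul_prod_erase S _ h0, hf0, pow_zero, one_mul]
  · rw [Finset.erase_eq_of_notMem h0]

variable {N} in
/-- Division of all exponents by `q` with remainder. -/
theorem exists_eq_pow_mul_prod [NoZeroDivisors N] [Nontrivial N] {S : Finset N}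
    (hS : ∀ s ∈ S, s ≠ 0) (f : N → ℕ) (q : ℕ+) :
    ∃ n : N, n ≠ 0 ∧ ∏ s ∈ S, s ^ f s = n ^ (q : ℕ) * ∏ s ∈ S, s ^ (f s % q) := by
  refine ⟨∏ s ∈ S, s ^ (f s / q),
    Finset.prod_ne_zero_iff.2 fun s hs => pow_ne_zero _ (hS s hs), ?_⟩
  rw [← Finset.prod_pow, ← Finset.prod_mul_distrib]
  refine Finset.prod_congr rfl fun s _ => ?_
  rw [← pow_mul, ← pow_add, Nat.div_add_mod']

end Generators

section Bounded

variable (N : Type u) [CommMonoidWithZero N] [Monoid.FG N] [Nontrivial N] [NoZeroDivisors N]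
  [IsCancelMulZero N]

/-- The sets `L_q(x, N)`, for `x` with coordinates in `[0, q - 1]`, are generated by their elements
in a box which depends neither on `q` nor on `x`. -/
theorem exists_bounded_generators {d : ℕ} (e : (DiffBinoid N)ˣ ≃* Multiplicative (Fin d → ℤ)) :
    ∃ C : ℕ, ∀ (q : ℕ+) (x : (DiffBinoid N)ˣ),
      (∀ i, 0 ≤ (e x).toAdd i ∧ (e x).toAdd i ≤ (q : ℤ) - 1) →
      ∀ m ∈ LSet N q (x : DiffBinoid N), m ≠ 0 →
        ∃ (n : N) (b : (DiffBinoid N)ˣ), (b : DiffBinoid N) ∈ LSet N q (x : DiffBinoid N) ∧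
          m = n • (b : DiffBinoid N) ∧ ∀ i, |(e b).toAdd i| ≤ (C : ℤ) := by
  obtain ⟨S, hS0, hS⟩ := exists_finset_generators N
  obtain ⟨v, hv⟩ := exists_unit_toDiff N
  refine ⟨1 + ∑ s ∈ S, ∑ i, ((e (v s)).toAdd i).natAbs, fun q x hx m ⟨y, hy⟩ hm => ?_⟩
  have hy0 : y ≠ 0 := by
    rintro rfl
    rw [toDiff_zero] at hy
    exact (x.isUnit.mul ((isUnit_of_ne_zero hm).pow _)).ne_zero hy.symm
  obtain ⟨f, rfl⟩ := hS y hy0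
  obtain ⟨n, hn, hf⟩ := exists_eq_pow_mul_prod hS0 f q
  lift m to (DiffBinoid N)ˣ using isUnit_of_ne_zero hm
  have hb : x * ((v n)⁻¹ * m) ^ (q : ℕ) = ∏ s ∈ S, v s ^ (f s % q) := by
    rw [mul_pow, mul_left_comm, inv_pow, inv_mul_eq_iff_eq_mul]
    ext
    rw [hf, map_mul, map_pow, map_prod] at hy
    push_cast
    rw [← hy, hv n hn]
    congr 1
    exact Finset.prod_congr rfl fun s hs => by rw [map_pow, hv s (hS0 s hs)]
  refine ⟨n, (v n)⁻¹ * m, ⟨∏ s ∈ S, s ^ (f s % q), ?_⟩, ?_, fun i => ?_⟩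
  · rw [← Units.val_pow_eq_pow_val, ← Units.val_mul, hb, map_prod, Units.coe_prod]
    exact Finset.prod_congr rfl fun s hs => by
      rw [map_pow, Units.val_pow_eq_pow_val, hv s (hS0 s hs)]
  · rw [smul_diffBinoid_def, ← hv n hn, ← Units.val_mul, mul_inv_cancel_left]
  · set b := (v n)⁻¹ * m
    have hcoord : (e x).toAdd i + q * (e b).toAdd i =
        ∑ s ∈ S, ((f s % q : ℕ) : ℤ) * (e (v s)).toAdd i := by
      have := congrFun (congrArg (fun u => (e u).toAdd) hb) i
      simpa [toAdd_prod] using this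
    have hsum : |∑ s ∈ S, ((f s % q : ℕ) : ℤ) * (e (v s)).toAdd i| ≤
        q * ∑ s ∈ S, ∑ j, |(e (v s)).toAdd j| := by
      rw [Finset.mul_sum]
      refine (Finset.abs_sum_le_sum_abs _ _).trans (Finset.sum_le_sum fun s _ => ?_)
      rw [abs_mul, Nat.abs_cast]
      refine mul_le_mul ?_ ?_ (abs_nonneg _) (Nat.cast_nonneg _)
      · exact_mod_cast (Nat.mod_lt _ q.pos).le
      · exact Finset.single_le_sum (f := fun j => |(e (v s)).toAdd j|)
          (fun j _ => abs_nonneg _) (Finset.mem_univ i)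
    have hq : (0 : ℤ) < q := by exact_mod_cast q.pos
    push_cast
    rw [← hcoord] at hsum
    obtain ⟨h1, h2⟩ := abs_le.1 hsum
    obtain ⟨hx1, hx2⟩ := hx i
    refine abs_le.2 ⟨?_, ?_⟩
    · refine le_of_mul_le_mul_left ?_ hq
      linarith
    · refine le_of_mul_le_mul_left ?_ hq
      linarith

end Bounded

/-! ### Coordinates on the difference group -/

section Coordinates

variable (N : Type u) [CommMonoidWithZero N] [Monoid.FG N] [Nontrivial N] [NoZeroDivisors N]
  [IsCancelMulZero N]

theorem fg_units_diffBinoid : Group.FG (DiffBinoid N)ˣ := by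
  obtain ⟨S, hS0, hS⟩ := exists_finset_generators N
  obtain ⟨v, hv⟩ := exists_unit_toDiff N
  have hmem : ∀ y ≠ 0, v y ∈ Subgroup.closure (v '' S) := by
    intro y hy
    obtain ⟨f, hf⟩ := hS y hy
    have hprod : v y = ∏ s ∈ S, v s ^ f s := by
      ext
      rw [hv y hy, Units.coe_prod, hf, map_prod]
      exact Finset.prod_congr rfl fun s hs => by
        rw [map_pow, Units.val_pow_eq_pow_val, hv s (hS0 s hs)]
    rw [hprod]
    exact Subgroup.prod_mem _ fun s hs =>
      Subgroup.pow_mem _ (Subgroup.subset_closure (Set.mem_image_of_mem v hs)) _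
  refine Group.fg_iff.2 ⟨v '' S, eq_top_iff.2 fun u _ => ?_, S.finite_toSet.image v⟩
  obtain ⟨a, b, hb, h⟩ := exists_mul_toDiff_eq (u : DiffBinoid N)
  have ha : a ≠ 0 := by
    rintro rfl
    rw [toDiff_zero] at h
    exact (u.isUnit.mul (isUnit_toDiff hb)).ne_zero h
  have hu : u = v a * (v b)⁻¹ := by
    rw [eq_mul_inv_iff_mul_eq]
    ext
    rw [Units.val_mul, hv a ha, hv b hb, h]
  rw [hu]
  exact Subgroup.mul_mem _ (hmem a ha) (Subgroup.inv_mem _ (hmem b hb))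

theorem exists_coordinates [IsMulTorsionFree N] :
    ∃ d : ℕ, Nonempty ((DiffBinoid N)ˣ ≃* Multiplicative (Fin d → ℤ)) := by
  have : Module.Finite ℤ (Additive (DiffBinoid N)ˣ) :=
    Module.Finite.iff_addGroup_fg.2 (GroupFG.iff_add_fg.1 (fg_units_diffBinoid N))
  exact ⟨_, ⟨AddEquiv.toMultiplicativeRight
    (Module.finBasis ℤ (Additive (DiffBinoid N)ˣ)).equivFun.toAddEquiv⟩⟩

end Coordinates

/-! ### The components of the Frobenius sets -/

section Components

variable {N : Type u}

/-- The identity map from `^qN` to the binoid `N` underlying it. -/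
def FrobeniusSet.toBinoid {q : ℕ+} (s : FrobeniusSet N q) : N :=
  s

theorem FrobeniusSet.toBinoid_injective {q : ℕ+} :
    Function.Injective (toBinoid : FrobeniusSet N q → N) :=
  fun _ _ h => h

variable [CommMonoidWithZero N]

theorem FrobeniusSet.toBinoid_zero {q : ℕ+} : (0 : FrobeniusSet N q).toBinoid = 0 :=
  rfl

theorem FrobeniusSet.toBinoid_smul {q : ℕ+} (n : N) (s : FrobeniusSet N q) :
    (n • s).toBinoid = n ^ (q : ℕ) * s.toBinoid :=
  rfl

theorem FrobeniusSet.eq_zero_or_eq_zero_of_smul_eq_zero [NoZeroDivisors N] {q : ℕ+} (n : N)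
    (s : FrobeniusSet N q) (h : n • s = 0) : n = 0 ∨ s = 0 :=
  (mul_eq_zero.1 (show n ^ (q : ℕ) * s.toBinoid = 0 from h)).imp eq_zero_of_pow_eq_zero id

variable [Nontrivial N] [NoZeroDivisors N] [IsCancelMulZero N]

/-- Two elements of `^qN` are linked exactly if they differ by a `q`-th multiple in the difference
group. -/
theorem FrobeniusSet.linked_iff {q : ℕ+} {s y : FrobeniusSet N q} :
    Linked N s y ↔ ∃ u : (DiffBinoid N)ˣ,
      toDiff N s.toBinoid = (u : DiffBinoid N) ^ (q : ℕ) * toDiff N y.toBinoid := by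
  constructor
  · rintro ⟨n, k, hn, hk, h⟩
    obtain ⟨v, hv⟩ := isUnit_toDiff hn
    obtain ⟨w, hw⟩ := isUnit_toDiff hk
    have h' := congrArg (toDiff N) (congrArg toBinoid h)
    rw [toBinoid_smul, toBinoid_smul, map_mul, map_mul, map_pow, map_pow, ← hv, ← hw,
      ← Units.val_pow_eq_pow_val, ← Units.eq_inv_mul_iff_mul_eq] at h'
    refine ⟨v⁻¹ * w, ?_⟩
    rw [h', Units.val_mul, mul_pow, mul_assoc, ← Units.val_pow_eq_pow_val v⁻¹, inv_pow]
  · rintro ⟨u, hu⟩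
    obtain ⟨a, b, hb, h⟩ := exists_mul_toDiff_eq (u : DiffBinoid N)
    have ha : a ≠ 0 := by
      rintro rfl
      rw [toDiff_zero] at h
      exact (u.isUnit.mul (isUnit_toDiff hb)).ne_zero h
    refine ⟨b, a, hb, ha, toBinoid_injective (toDiff_injective ?_)⟩
    rw [toBinoid_smul, toBinoid_smul, map_mul, map_mul, map_pow, map_pow, hu, ← h, mul_pow,
      mul_left_comm, mul_assoc]

variable [IsMulTorsionFree N]

/-- The isomorphism is `m ↦ x * m ^ q`. -/
theorem areIsomorphic_LSet_linkClass {q : ℕ+} {x w : (DiffBinoid N)ˣ} {y : FrobeniusSet N q}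
    (hy : toDiff N y.toBinoid = x * (w : DiffBinoid N) ^ (q : ℕ)) :
    AreIsomorphic N (LSet N q (x : DiffBinoid N)) (linkClass N y) := by
  have hspec : ∀ m : LSet N q (x : DiffBinoid N), ∃ s : linkClass N y,
      toDiff N (s : FrobeniusSet N q).toBinoid = x * (m : DiffBinoid N) ^ (q : ℕ) := by
    rintro ⟨m, s, hs⟩
    refine ⟨⟨s, ?_⟩, hs⟩
    by_cases hm : m = 0
    · refine Or.inl (FrobeniusSet.toBinoid_injective (toDiff_injective ?_))
      refine hs.trans ?_
      rw [hm, zero_pow q.ne_zero, mul_zero, FrobeniusSet.toBinoid_zero, toDiff_zero]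
    · lift m to (DiffBinoid N)ˣ using isUnit_of_ne_zero hm
      refine Or.inr (FrobeniusSet.linked_iff.2 ⟨m * w⁻¹, hs.trans ?_⟩)
      rw [hy, mul_left_comm, ← mul_pow, ← Units.val_mul, inv_mul_cancel_right]
  choose g hg using hspec
  have hext : ∀ {s t : linkClass N y}, toDiff N (s : FrobeniusSet N q).toBinoid =
      toDiff N (t : FrobeniusSet N q).toBinoid → s = t := fun h =>
    Subtype.ext (FrobeniusSet.toBinoid_injective (toDiff_injective h))
  have hinj : Function.Injective g := by
    intro m m' h
    have hpow := hg m
    rw [h, hg m'] at hpow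
    exact Subtype.ext
      (pow_left_injective q.ne_zero (x.isUnit.mul_right_injective hpow)).symm
  have hsurj : Function.Surjective g := by
    intro s
    suffices ∃ m : DiffBinoid N, toDiff N (s : FrobeniusSet N q).toBinoid = x * m ^ (q : ℕ) by
      obtain ⟨m, hm⟩ := this
      exact ⟨⟨m, _, hm⟩, hext ((hg ⟨m, _, hm⟩).trans hm.symm)⟩
    obtain h | h := mem_linkClass.1 s.2
    · refine ⟨0, ?_⟩
      rw [h, FrobeniusSet.toBinoid_zero, toDiff_zero, zero_pow q.ne_zero, mul_zero]
    · obtain ⟨u, hu⟩ := FrobeniusSet.linked_iff.1 h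
      exact ⟨u * w, by rw [hu, hy, mul_pow, mul_left_comm]⟩
  refine ⟨Equiv.ofBijective g ⟨hinj, hsurj⟩, hext ((hg 0).trans ?_), fun n m =>
    hext ((hg (n • m)).trans ?_)⟩
  · change (x : DiffBinoid N) * 0 ^ (q : ℕ) = toDiff N 0
    rw [zero_pow q.ne_zero, mul_zero, toDiff_zero]
  · change (x : DiffBinoid N) * (toDiff N n * (m : DiffBinoid N)) ^ (q : ℕ) =
      toDiff N (n ^ (q : ℕ) * (g m : FrobeniusSet N q).toBinoid)
    rw [map_mul, map_pow, hg m, mul_pow, mul_left_comm]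

/-- Every irreducible component is isomorphic to `L_q(x, N)` for some `x` with coordinates in
`[0, q - 1]`: these are the remainders modulo `q` of the coordinates of any of its elements. -/
theorem FrobeniusComponent.exists_areIsomorphic_LSet {d : ℕ}
    (e : (DiffBinoid N)ˣ ≃* Multiplicative (Fin d → ℤ)) (A : FrobeniusComponent N) :
    ∃ x : (DiffBinoid N)ˣ, (∀ i, 0 ≤ (e x).toAdd i ∧ (e x).toAdd i ≤ (A.q : ℤ) - 1) ∧
      AreIsomorphic N (LSet N A.q (x : DiffBinoid N)) A.component := by
  obtain ⟨⟨y, hyA⟩, hy⟩ := A.isComponent.1.1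
  have hy0 : y ≠ 0 := fun h => hy (Subtype.ext h)
  rw [A.isComponent.eq_linkClass FrobeniusSet.eq_zero_or_eq_zero_of_smul_eq_zero
    hyA hy0]
  obtain ⟨u, hu⟩ := isUnit_toDiff (a := y.toBinoid) hy0
  have hq : (0 : ℤ) < A.q := by exact_mod_cast A.q.pos
  refine ⟨e.symm (Multiplicative.ofAdd fun i => (e u).toAdd i % A.q), fun i => ?_,
    areIsomorphic_LSet_linkClass
      (w := e.symm (Multiplicative.ofAdd fun i => (e u).toAdd i / A.q)) ?_⟩
  · rw [MulEquiv.apply_symm_apply]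
    exact ⟨Int.emod_nonneg _ hq.ne', Int.le_sub_one_of_lt (Int.emod_lt_of_pos _ hq)⟩
  · rw [← hu, ← Units.val_pow_eq_pow_val, ← Units.val_mul]
    congr 1
    apply e.injective
    rw [map_mul, map_pow, MulEquiv.apply_symm_apply, MulEquiv.apply_symm_apply]
    apply Multiplicative.toAdd.injective
    funext i
    simp [Int.emod_add_mul_ediv]

variable (N) in
theorem finite_frobeniusComponentClasses [Monoid.FG N] :
    Finite (FrobeniusComponentClasses N) := by
  obtain ⟨d, ⟨e⟩⟩ := exists_coordinates N
  obtain ⟨C, hC⟩ := exists_bounded_generators N e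
  let B : Set (DiffBinoid N)ˣ := {b | ∀ i, |(e b).toAdd i| ≤ (C : ℤ)}
  have hB : B.Finite := by
    refine Set.Finite.subset ((Set.finite_Icc (fun _ : Fin d => -(C : ℤ)) fun _ => (C : ℤ)).preimage
      (f := fun b => (e b).toAdd) (Multiplicative.toAdd.injective.comp e.injective).injOn) ?_
    exact fun b hb => ⟨fun i => (abs_le.1 (hb i)).1, fun i => (abs_le.1 (hb i)).2⟩
  choose x hx hiso using fun A : FrobeniusComponent N => A.exists_areIsomorphic_LSet e
  have hle : ∀ A A' : FrobeniusComponent N,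
      (∀ b ∈ B, (b : DiffBinoid N) ∈ LSet N A.q (x A : DiffBinoid N) →
        (b : DiffBinoid N) ∈ LSet N A'.q (x A' : DiffBinoid N)) →
      ∀ m ∈ LSet N A.q (x A : DiffBinoid N), m ∈ LSet N A'.q (x A' : DiffBinoid N) := by
    intro A A' h m hm
    by_cases hm0 : m = 0
    · exact hm0 ▸ (LSet N A'.q (x A' : DiffBinoid N)).zero_mem'
    · obtain ⟨n, b, hb, rfl, hbB⟩ := hC A.q (x A) (hx A) m hm hm0
      exact (LSet N A'.q (x A' : DiffBinoid N)).smul_mem' n _ (h b hbB hb)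
  have : Finite B := hB
  let F (A : FrobeniusComponent N) : Set B :=
    {b | ((b : (DiffBinoid N)ˣ) : DiffBinoid N) ∈ LSet N A.q (x A : DiffBinoid N)}
  have hF : ∀ A A' : FrobeniusComponent N, F A = F A' → A ≈ A' := by
    intro A A' h
    have hL : LSet N A.q (x A : DiffBinoid N) = LSet N A'.q (x A' : DiffBinoid N) :=
      SetLike.ext fun m =>
        ⟨hle A A' (fun b hb => (Set.ext_iff.1 h ⟨b, hb⟩).1) m,
          hle A' A (fun b hb => (Set.ext_iff.1 h ⟨b, hb⟩).2) m⟩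
    obtain ⟨f, hf0, hf⟩ := hiso A
    have hA' := hiso A'
    rw [← hL] at hA'
    obtain ⟨g, hg0, hg⟩ := hA'
    refine ⟨f.symm.trans g, ?_, fun n s => ?_⟩
    · rw [Equiv.trans_apply, ← hf0, Equiv.symm_apply_apply, hg0]
    · obtain ⟨m, rfl⟩ := f.surjective s
      rw [Equiv.trans_apply, Equiv.trans_apply, ← hf, Equiv.symm_apply_apply,
        Equiv.symm_apply_apply, hg]
  refine Finite.of_injective
    (fun c : FrobeniusComponentClasses N => F (Quotient.out (s := frobeniusComponentSetoid N) c))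
    fun c c' h => ?_
  rw [← Quotient.out_eq (s := frobeniusComponentSetoid N) c,
    ← Quotient.out_eq (s := frobeniusComponentSetoid N) c']
  exact Quotient.sound (hF _ _ h)

end Components

end Binoid

/-- `N` is a finitely generated, positive (`Nontrivial N` and `Subsingleton Nˣ`), integral,
cancellative and torsion-free commutative binoid.  The first claim is the finiteness of the set of
isomorphism classes; the second one is the bound on the coordinates of the minimal generators of
`L_q(x, N)`, for every identification `e` of the difference group with `ℤ^d`. -/
theorem mainTheorem8 (N : Type u) [CommMonoidWithZero N] [Monoid.FG N]
    [Nontrivial N] [Subsingleton Nˣ] [NoZeroDivisors N] [IsCancelMulZero N] [IsMulTorsionFree N] :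
    Finite (Binoid.FrobeniusComponentClasses N) ∧
    ∀ (d : ℕ) (e : (Binoid.DiffBinoid N)ˣ ≃* Multiplicative (Fin d → ℤ)),
      ∃ C : ℕ, ∀ (q : ℕ+) (x : (Binoid.DiffBinoid N)ˣ),
        (∀ i, 0 ≤ (e x).toAdd i ∧ (e x).toAdd i ≤ (q : ℤ) - 1) →
        ∀ a : Binoid.LSet N q (x : Binoid.DiffBinoid N), Binoid.IsMinimalGenerator N a →
          ∃ u : (Binoid.DiffBinoid N)ˣ, (u : Binoid.DiffBinoid N) = (a : Binoid.DiffBinoid N) ∧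
            ∀ i, |(e u).toAdd i| ≤ (C : ℤ) := by
  refine ⟨Binoid.finite_frobeniusComponentClasses N, fun d e => ?_⟩
  obtain ⟨C, hC⟩ := Binoid.exists_bounded_generators N e
  refine ⟨C, fun q x hx a ha => ?_⟩
  -- `x = k / l` gives `x * l ^ q = k * l ^ (q - 1)`, so `l` is a nonzero element of `L_q(x, N)`.
  obtain ⟨k, l, hl, hkl⟩ := Binoid.exists_mul_toDiff_eq (x : Binoid.DiffBinoid N)
  have hlL : Binoid.toDiff N l ∈ Binoid.LSet N q (x : Binoid.DiffBinoid N) := by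
    refine ⟨k * l ^ ((q : ℕ) - 1), ?_⟩
    rw [map_mul, map_pow, ← hkl, mul_assoc, mul_pow_sub_one q.ne_zero]
  have ha0 : (a : Binoid.DiffBinoid N) ≠ 0 := fun h =>
    ha.ne_zero (s := ⟨Binoid.toDiff N l, hlL⟩)
      (fun h' => (Binoid.isUnit_toDiff hl).ne_zero (congrArg Subtype.val h')) (Subtype.ext h)
  obtain ⟨n, b, hb, hab, hbC⟩ := hC q x hx a a.2 ha0
  refine ⟨b, ?_, hbC⟩
  have hfree : ∀ m : N, m • a = a → m = 1 := by
    intro m hm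
    have hm' : Binoid.toDiff N m * a = a := congrArg Subtype.val hm
    apply Binoid.toDiff_injective
    rw [map_one]
    exact (Binoid.isUnit_of_ne_zero ha0).mul_left_injective (hm'.trans (one_mul _).symm)
  exact (congrArg Subtype.val
    (ha.eq_of_eq_smul hfree (b := ⟨b, hb⟩) (Subtype.ext hab))).symm
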